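/- For an integer $m\ge 0$ let $\mathbb{S}^m=\{x\in\mathbb{R}^{m+1}: \|x\|=1\}$ be the unit sphere, regarded as a metric space with the geodesic distance $d_{\mathbb{S}^m}(x,x')=\arccos\langle x,x'\rangle$. A correspondence between two sets $X$ and $Y$ is a relation $R\subseteq X\times Y$ whose projections to $X$ and to $Y$ are both surjective; if $X$ and $Y$ are bounded metric spaces and $R$ is non-empty, its distortion is $\operatorname{dis}(R)=\sup_{(x,y),(x',y')\in R}|d_X(x,x')-d_Y(y,y')|$. Let $d_{\mathrm{GH}}(X,Y)$ denote the Gromov–Hausdorff distance, i.e. the infimum of the Hausdorff distances between $f(X)$ and $g(Y)$ over all metric spaces $Z$ and all isometric embeddings $f:X\to Z$ and $g:Y\to Z$. Then there exists a correspondence $R$ between $\mathbb{S}^1$ and $\mathbb{S}^3$ with $\operatorname{dis}(R)\le \frac{2\pi}{3}$. Moreover, $d_{\mathrm{GH}}(\mathbb{S}^1,\mathbb{S}^3)=\frac{\pi}{3}$. -/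

import Mathlib

noncomputable section

/-- The `m`-dimensional sphere, as the set of unit vectors of `ℝ^(m+1)`. This is a type synonym,
so that it does not inherit the Euclidean (chordal) metric: it is given the geodesic one below. -/
def GeodesicSphere (m : ℕ) : Type :=
  {x : EuclideanSpace ℝ (Fin (m + 1)) // ‖x‖ = 1}

namespace GeodesicSphere

/-- The unit vector underlying a point of the sphere. -/
def vec {m : ℕ} (x : GeodesicSphere m) : EuclideanSpace ℝ (Fin (m + 1)) := x.1

theorem norm_vec {m : ℕ} (x : GeodesicSphere m) : ‖x.vec‖ = 1 := x.2

/-- The geodesic distance `arccos ⟨x, y⟩`. -/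
def geodDist {m : ℕ} (x y : GeodesicSphere m) : ℝ :=
  Real.arccos (inner ℝ x.vec y.vec)

theorem geodDist_eq_angle {m : ℕ} (x y : GeodesicSphere m) :
    geodDist x y = InnerProductGeometry.angle x.vec y.vec := by
  simp [geodDist, InnerProductGeometry.angle, norm_vec]

/-- The sphere with its geodesic distance is a metric space. -/
instance instMetricSpace (m : ℕ) : MetricSpace (GeodesicSphere m) where
  dist := geodDist
  dist_self x := by
    change geodDist x x = 0
    simp [geodDist, norm_vec]
  dist_comm x y := by
    change geodDist x y = geodDist y x
    simp only [geodDist, real_inner_comm]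
  dist_triangle x y z := by
    change geodDist x z ≤ geodDist x y + geodDist y z
    simp only [geodDist_eq_angle]
    exact InnerProductGeometry.angle_le_angle_add_angle _ _ _
  eq_of_dist_eq_zero {x y} h := by
    change geodDist x y = 0 at h
    have h1 : (1 : ℝ) ≤ inner ℝ x.vec y.vec := Real.arccos_eq_zero.mp h
    have h2 : inner ℝ x.vec y.vec ≤ (1 : ℝ) := by
      simpa [norm_vec] using real_inner_le_norm x.vec y.vec
    exact Subtype.ext
      ((inner_eq_one_iff_of_norm_eq_one (norm_vec x) (norm_vec y)).mp (le_antisymm h2 h1))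

theorem dist_def {m : ℕ} (x y : GeodesicSphere m) :
    dist x y = Real.arccos (inner ℝ x.vec y.vec) := rfl

instance instNonempty (m : ℕ) : Nonempty (GeodesicSphere m) :=
  ⟨⟨EuclideanSpace.single 0 1, by simp⟩⟩

instance instCompactSpace (m : ℕ) : CompactSpace (GeodesicSphere m) := by
  let f : Metric.sphere (0 : EuclideanSpace ℝ (Fin (m + 1))) 1 → GeodesicSphere m :=
    fun x => ⟨x.1, by simpa using x.2⟩
  have hf : Continuous f := by
    rw [continuous_iff_continuousAt]
    intro x
    refine tendsto_iff_dist_tendsto_zero.mpr ?_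
    have hc : Continuous fun y : Metric.sphere (0 : EuclideanSpace ℝ (Fin (m + 1))) 1 =>
        Real.arccos (inner ℝ y.1 x.1) := by fun_prop
    have h0 : Real.arccos (inner ℝ x.1 x.1) = 0 := dist_self (f x)
    have := hc.tendsto x
    rw [h0] at this
    exact this
  have hs : Function.Surjective f := fun y => ⟨⟨y.1, by simpa using y.2⟩, rfl⟩
  exact hs.compactSpace hf

end GeodesicSphere

/-- A relation `R ⊆ X × Y` is a correspondence if both projections map it onto the whole factor. -/
def IsCorrespondence {X Y : Type*} (R : Set (X × Y)) : Prop :=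
  Prod.fst '' R = Set.univ ∧ Prod.snd '' R = Set.univ

/-- The distortion `sup |d(x, x') - d(y, y')|` over all `(x, y), (x', y') ∈ R`. It takes values in
`[0, ∞]`, so that the supremum is always the true one. -/
def distortion {X Y : Type*} [MetricSpace X] [MetricSpace Y] (R : Set (X × Y)) : ENNReal :=
  ⨆ p ∈ R, ⨆ q ∈ R, ENNReal.ofReal |dist p.1 q.1 - dist p.2 q.2|

end

/-! Upper bound: write a point of the 3-sphere as `(z, w)` in `ℂ²` and send it to the cube root `u`
of `w / |w|` nearest to `z`, or to `z` itself if `w = 0`. If two images are at distance `t ≤ π / 3`,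
the `w`-parts make an angle whose cosine is `cos (3 * t)`, and the `z`-parts an angle of at most
`2π/3 + t`; both cosines are at least `cos (2π/3 + t)`, so the points are at most `2π/3 + t` apart
(`CubeRootRel.dist_le`). Antipodal symmetry gives the reverse estimate.

Lower bound: a coupling of cost below `π / 3` gives a map from the 3-sphere to the circle of
distortion below `2π/3`, which can be made odd. On a fine grid of a hemisphere of a 2-sphere,
neighbours have images less than `2π/3` apart, so winding numbers are defined and vanish around
every triangle. The boundary then has winding number zero, while oddness forces it to be odd
(`not_antiperiodic_of_grid`): a discrete Borsuk–Ulam argument. -/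

open Real InnerProductGeometry

/-! ### Antipodes and complex coordinates. -/

namespace GeodesicSphere

/-- The antipodal point. -/
def antipode {m : ℕ} (x : GeodesicSphere m) : GeodesicSphere m :=
  ⟨-x.vec, by rw [norm_neg, norm_vec]⟩

theorem vec_antipode {m : ℕ} (x : GeodesicSphere m) : x.antipode.vec = -x.vec := rfl

theorem antipode_antipode {m : ℕ} (x : GeodesicSphere m) : x.antipode.antipode = x :=
  Subtype.ext (neg_neg x.vec)

theorem dist_antipode_left {m : ℕ} (x y : GeodesicSphere m) :
    dist x.antipode y = π - dist x y := by
  rw [dist_def, dist_def, vec_antipode, inner_neg_left, arccos_neg]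

theorem dist_antipode_right {m : ℕ} (x y : GeodesicSphere m) :
    dist x y.antipode = π - dist x y := by
  rw [dist_comm, dist_antipode_left, dist_comm]

theorem antipode_ne {m : ℕ} (x : GeodesicSphere m) : x.antipode ≠ x := by
  intro h
  have := dist_antipode_left x x
  rw [h, dist_self, sub_zero] at this
  exact pi_ne_zero this.symm

theorem dist_le_pi {m : ℕ} (x y : GeodesicSphere m) : dist x y ≤ π := arccos_le_pi _

/-- A point of the circle as a complex number. -/
def toComplex (u : GeodesicSphere 1) : ℂ := ⟨u.vec 0, u.vec 1⟩

/-- The point of the circle given by a complex number of norm one. -/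
def ofComplex (z : ℂ) (hz : ‖z‖ = 1) : GeodesicSphere 1 :=
  ⟨!₂[z.re, z.im], by
    rw [EuclideanSpace.norm_eq, Fin.sum_univ_two]
    simpa [Complex.norm_eq_sqrt_sq_add_sq] using hz⟩

theorem toComplex_ofComplex (z : ℂ) (hz : ‖z‖ = 1) : (ofComplex z hz).toComplex = z := rfl

theorem norm_toComplex (u : GeodesicSphere 1) : ‖u.toComplex‖ = 1 := by
  have := u.norm_vec
  rw [EuclideanSpace.norm_eq, Fin.sum_univ_two] at this
  simpa [Complex.norm_eq_sqrt_sq_add_sq, toComplex] using this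

theorem toComplex_ne_zero (u : GeodesicSphere 1) : u.toComplex ≠ 0 := by
  rw [← norm_ne_zero_iff, norm_toComplex]
  exact one_ne_zero

theorem toComplex_injective : Function.Injective toComplex := by
  intro u v h
  refine Subtype.ext (PiLp.ext fun i => ?_)
  rw [Complex.ext_iff] at h
  fin_cases i
  · exact h.1
  · exact h.2

theorem toComplex_antipode (u : GeodesicSphere 1) : u.antipode.toComplex = -u.toComplex := by
  apply Complex.ext <;> simp [toComplex, vec_antipode]

theorem dist_eq_angle_toComplex (u v : GeodesicSphere 1) :
    dist u v = angle u.toComplex v.toComplex := by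
  rw [dist_def, angle, norm_toComplex, norm_toComplex, PiLp.inner_apply, Fin.sum_univ_two]
  simp [toComplex]

theorem dist_eq_abs_arg (u v : GeodesicSphere 1) :
    dist u v = |(v.toComplex / u.toComplex).arg| := by
  rw [dist_comm, dist_eq_angle_toComplex,
    Complex.angle_eq_abs_arg v.toComplex_ne_zero u.toComplex_ne_zero]

/-- The first complex coordinate of a point of the `3`-sphere. -/
def fstComplex (x : GeodesicSphere 3) : ℂ := ⟨x.vec 0, x.vec 1⟩

/-- The second complex coordinate of a point of the `3`-sphere. -/
def sndComplex (x : GeodesicSphere 3) : ℂ := ⟨x.vec 2, x.vec 3⟩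

theorem fstComplex_antipode (x : GeodesicSphere 3) : x.antipode.fstComplex = -x.fstComplex := by
  apply Complex.ext <;> simp [fstComplex, vec_antipode]

theorem sndComplex_antipode (x : GeodesicSphere 3) : x.antipode.sndComplex = -x.sndComplex := by
  apply Complex.ext <;> simp [sndComplex, vec_antipode]

theorem inner_vec_eq_complex (x y : GeodesicSphere 3) :
    inner ℝ x.vec y.vec =
      inner ℝ x.fstComplex y.fstComplex + inner ℝ x.sndComplex y.sndComplex := by
  rw [PiLp.inner_apply, Fin.sum_univ_four]
  simp [fstComplex, sndComplex]
  ring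

theorem norm_sq_complex (x : GeodesicSphere 3) :
    ‖x.fstComplex‖ ^ 2 + ‖x.sndComplex‖ ^ 2 = 1 := by
  have h := inner_vec_eq_complex x x
  simp only [real_inner_self_eq_norm_sq] at h
  rw [← h, norm_vec, one_pow]

/-! ### The cube root map and its distortion. -/

/-- `u` is a cube root of the direction of the second complex coordinate of `x`, at angle at most
`π / 3` from the first one. -/
def CubeRootRel (u : GeodesicSphere 1) (x : GeodesicSphere 3) : Prop :=
  x.sndComplex = ‖x.sndComplex‖ * u.toComplex ^ 3 ∧
    ‖x.fstComplex‖ / 2 ≤ inner ℝ x.fstComplex u.toComplex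

theorem CubeRootRel.antipode {u : GeodesicSphere 1} {x : GeodesicSphere 3}
    (h : CubeRootRel u x) : CubeRootRel u.antipode x.antipode := by
  constructor
  · rw [sndComplex_antipode, toComplex_antipode, norm_neg, Odd.neg_pow (by decide), mul_neg, ← h.1]
  · rw [fstComplex_antipode, toComplex_antipode, norm_neg, inner_neg_neg]
    exact h.2

theorem angle_le_pi_div_three {z u : ℂ} (hz : z ≠ 0) (hu : ‖u‖ = 1)
    (h : ‖z‖ / 2 ≤ inner ℝ z u) : angle z u ≤ π / 3 := by
  have hz' : 0 < ‖z‖ := norm_pos_iff.mpr hz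
  have h3 : π / 3 = arccos (1 / 2) := by
    rw [← cos_pi_div_three, arccos_cos (by positivity) (by linarith [pi_pos])]
  rw [h3, angle, hu, mul_one]
  refine arccos_le_arccos ?_
  rw [le_div_iff₀ hz']
  linarith

/-- The number `w = v * conj u` has modulus one and real part `cos (angle u v)`, so this is the
triple-angle formula for the real part of `w ^ 3`. -/
theorem inner_cube {u v : ℂ} (hu : ‖u‖ = 1) (hv : ‖v‖ = 1) :
    inner ℝ (u ^ 3) (v ^ 3) = cos (3 * angle u v) := by
  have h : inner ℝ u v = cos (angle u v) := by rw [cos_angle, hu, hv, mul_one, div_one]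
  have hu' : u.re ^ 2 + u.im ^ 2 = 1 := by
    rw [← Complex.sq_norm_sub_sq_re u, hu]; ring
  have hv' : v.re ^ 2 + v.im ^ 2 = 1 := by
    rw [← Complex.sq_norm_sub_sq_re v, hv]; ring
  have hn : inner ℝ (u ^ 3) (v ^ 3) = ((v * (starRingEnd ℂ) u) ^ 3).re := by
    rw [Complex.inner, mul_pow, map_pow]
  have key : ∀ w : ℂ, w.re ^ 2 + w.im ^ 2 = 1 → (w ^ 3).re = 4 * w.re ^ 3 - 3 * w.re := by
    intro w hw
    have : (w ^ 3).re = w.re ^ 3 - 3 * w.re * w.im ^ 2 := by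
      rw [pow_succ, pow_two]
      simp only [Complex.mul_re, Complex.mul_im]
      ring
    rw [this, eq_sub_of_add_eq' hw]
    ring
  rw [cos_three_mul, ← h, hn, Complex.inner, key]
  simp only [Complex.mul_re, Complex.mul_im, Complex.conj_re, Complex.conj_im]
  linear_combination (u.re ^ 2 + u.im ^ 2) * hv' + hu'

theorem CubeRootRel.dist_le {u v : GeodesicSphere 1} {x y : GeodesicSphere 3}
    (hx : CubeRootRel u x) (hy : CubeRootRel v y) : dist x y ≤ 2 * π / 3 + dist u v := by
  set t := dist u v with ht
  have ht0 : 0 ≤ t := dist_nonneg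
  -- For `t ≥ π / 3` the bound is at least the diameter `π`.
  rcases le_total (π / 3) t with h | h
  · linarith [dist_le_pi x y]
  -- The weights in `hsum` add up to at most 1, not exactly 1, so the sign of this cosine matters.
  have hneg : cos (2 * π / 3 + t) ≤ 0 :=
    cos_nonpos_of_pi_div_two_le_of_le (by linarith [pi_pos]) (by linarith [pi_pos])
  have hfst : ‖x.fstComplex‖ * ‖y.fstComplex‖ * cos (2 * π / 3 + t) ≤
      inner ℝ x.fstComplex y.fstComplex := by
    by_cases hx0 : x.fstComplex = 0
    · simp [hx0]
    by_cases hy0 : y.fstComplex = 0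
    · simp [hy0]
    have h1 := angle_le_pi_div_three hx0 u.norm_toComplex hx.2
    have h2 := angle_le_pi_div_three hy0 v.norm_toComplex hy.2
    have h3 := angle_le_angle_add_angle x.fstComplex u.toComplex y.fstComplex
    have h4 := angle_le_angle_add_angle u.toComplex v.toComplex y.fstComplex
    rw [angle_comm v.toComplex] at h4
    rw [← dist_eq_angle_toComplex, ← ht] at h4
    rw [← cos_angle_mul_norm_mul_norm, mul_comm]
    refine mul_le_mul_of_nonneg_right ?_ (by positivity)
    exact cos_le_cos_of_nonneg_of_le_pi (angle_nonneg _ _) (by linarith) (by linarith)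
  have hsnd : ‖x.sndComplex‖ * ‖y.sndComplex‖ * cos (2 * π / 3 + t) ≤
      inner ℝ x.sndComplex y.sndComplex := by
    have : inner ℝ x.sndComplex y.sndComplex =
        ‖x.sndComplex‖ * ‖y.sndComplex‖ * cos (3 * t) := by
      rw [ht, dist_eq_angle_toComplex, ← inner_cube u.norm_toComplex v.norm_toComplex]
      conv_lhs => rw [hx.1, hy.1, ← Complex.real_smul, ← Complex.real_smul, real_inner_smul_left,
        real_inner_smul_right]
      ring
    rw [this]
    refine mul_le_mul_of_nonneg_left ?_ (by positivity)
    -- `3 * t ≤ 2π/3 + t` is exactly `t ≤ π / 3`.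
    exact cos_le_cos_of_nonneg_of_le_pi (by linarith) (by linarith) (by linarith)
  have hsum : ‖x.fstComplex‖ * ‖y.fstComplex‖ + ‖x.sndComplex‖ * ‖y.sndComplex‖ ≤ 1 := by
    nlinarith [norm_sq_complex x, norm_sq_complex y,
      sq_nonneg (‖x.fstComplex‖ - ‖y.fstComplex‖), sq_nonneg (‖x.sndComplex‖ - ‖y.sndComplex‖)]
  rw [dist_def, ← arccos_cos (x := 2 * π / 3 + t) (by linarith [pi_pos]) (by linarith)]
  refine arccos_le_arccos ?_
  rw [inner_vec_eq_complex]
  nlinarith [hfst, hsnd, hsum, hneg]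

/-- Replacing `v` and `y` by their antipodes turns both distances `d` into `π - d`, so the one-sided
bound yields the other side. -/
theorem CubeRootRel.abs_dist_sub_dist_le {u v : GeodesicSphere 1} {x y : GeodesicSphere 3}
    (hx : CubeRootRel u x) (hy : CubeRootRel v y) : |dist u v - dist x y| ≤ 2 * π / 3 := by
  have h1 := hx.dist_le hy
  have h2 := hx.dist_le hy.antipode
  rw [dist_antipode_right, dist_antipode_right] at h2
  rw [abs_le]
  constructor <;> linarith

/-- The three cube roots are `2π/3` apart, so one of them lies within `π / 3` of the direction of
`z`. -/
theorem exists_cube_root_near (z w : ℂ) :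
    ∃ u : ℂ, ‖u‖ = 1 ∧ w = ‖w‖ * u ^ 3 ∧ ‖z‖ / 2 ≤ inner ℝ z u := by
  set c : ℂ := Complex.exp ((w.arg / 3 : ℝ) * Complex.I) with hc
  have hcn : ‖c‖ = 1 := Complex.norm_exp_ofReal_mul_I _
  have hc3 : w = ‖w‖ * c ^ 3 := by
    rw [hc, ← Complex.exp_nat_mul]
    conv_lhs => rw [← Complex.norm_mul_exp_arg_mul_I w]
    congr 2
    push_cast
    ring
  have hs3 : √3 ^ 2 = 3 := Real.sq_sqrt (by norm_num)
  have hrot : ∀ e : ℝ, e ^ 2 = 3 → ‖(⟨-1 / 2, e / 2⟩ : ℂ)‖ = 1 ∧ (⟨-1 / 2, e / 2⟩ : ℂ) ^ 3 = 1 := by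
    intro e he
    constructor
    · rw [Complex.norm_eq_sqrt_sq_add_sq, Real.sqrt_eq_one]
      simp only
      linear_combination he / 4
    · apply Complex.ext
      · simp [pow_succ]
        linear_combination 3 / 8 * he
      · simp [pow_succ]
        linear_combination -e / 8 * he
  have hz : ‖z‖ ^ 2 = inner ℝ z c ^ 2 + inner ℝ z (Complex.I * c) ^ 2 := by
    have hc' : c.re ^ 2 + c.im ^ 2 = 1 := by
      rw [← Complex.sq_norm_sub_sq_re c, hcn]; ring
    have hz' : ‖z‖ ^ 2 = z.re ^ 2 + z.im ^ 2 := by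
      rw [← Complex.sq_norm_sub_sq_re z]; ring
    rw [hz']
    simp
    linear_combination -(z.re ^ 2 + z.im ^ 2) * hc'
  have hrotinner : ∀ e : ℝ, inner ℝ z (⟨-1 / 2, e / 2⟩ * c) =
      -inner ℝ z c / 2 + e / 2 * inner ℝ z (Complex.I * c) := by
    intro e
    simp
    ring
  set a := inner ℝ z c
  set b := inner ℝ z (Complex.I * c)
  rcases le_or_gt (‖z‖ / 2) a with h | h
  · exact ⟨c, hcn, hc3, h⟩
  -- Since `b² = (‖z‖ - a)(‖z‖ + a)`, the squared inequality reduces to `a ≤ ‖z‖ / 2`. It says that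
  -- `c` rotated by `2π/3` towards `z` works.
  have hab : ‖z‖ + a ≤ √3 * |b| := by
    refine abs_le_of_sq_le_sq' ?_ (by positivity) |>.2
    rw [mul_pow, hs3, sq_abs]
    have : 0 ≤ ‖z‖ + a := by nlinarith [norm_nonneg z, sq_nonneg b]
    nlinarith
  rcases le_total 0 b with hb | hb
  · rw [abs_of_nonneg hb] at hab
    obtain ⟨h1, h2⟩ := hrot (√3) hs3
    refine ⟨⟨-1 / 2, √3 / 2⟩ * c, by rw [norm_mul, h1, hcn, one_mul],
      by rw [mul_pow, h2, one_mul, ← hc3], ?_⟩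
    rw [hrotinner]
    linarith
  · rw [abs_of_nonpos hb] at hab
    obtain ⟨h1, h2⟩ := hrot (-√3) (by rw [neg_sq, hs3])
    refine ⟨⟨-1 / 2, -√3 / 2⟩ * c, by rw [norm_mul, h1, hcn, one_mul],
      by rw [mul_pow, h2, one_mul, ← hc3], ?_⟩
    rw [hrotinner]
    linarith

/-- When `w = 0` the cube root condition is void; the choice `u = z` there makes the map surjective.
-/
theorem exists_cubeRootRel (x : GeodesicSphere 3) :
    ∃ u : GeodesicSphere 1, CubeRootRel u x ∧ (x.sndComplex = 0 → u.toComplex = x.fstComplex) := by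
  by_cases h : x.sndComplex = 0
  · have hn : ‖x.fstComplex‖ = 1 := by
      have := norm_sq_complex x
      rw [h, norm_zero] at this
      nlinarith [norm_nonneg x.fstComplex]
    refine ⟨ofComplex x.fstComplex hn, ⟨by simp [h], ?_⟩, fun _ => rfl⟩
    rw [toComplex_ofComplex, real_inner_self_eq_norm_sq, hn]
    norm_num
  · obtain ⟨u, hu, h1, h2⟩ := exists_cube_root_near x.fstComplex x.sndComplex
    exact ⟨ofComplex u hu, ⟨h1, h2⟩, fun h' => absurd h' h⟩

theorem exists_surjective_abs_dist_sub_dist_le :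
    ∃ φ : GeodesicSphere 3 → GeodesicSphere 1, Function.Surjective φ ∧
      ∀ x y, |dist x y - dist (φ x) (φ y)| ≤ 2 * π / 3 := by
  choose φ hφ hφ' using exists_cubeRootRel
  refine ⟨φ, fun u => ?_, fun x y => ?_⟩
  · have hn : ‖(!₂[u.vec 0, u.vec 1, 0, 0] : EuclideanSpace ℝ (Fin 4))‖ = 1 := by
      have := u.norm_vec
      rw [EuclideanSpace.norm_eq, Fin.sum_univ_two] at this
      rw [EuclideanSpace.norm_eq, Fin.sum_univ_four]
      simpa using this
    exact ⟨⟨_, hn⟩, toComplex_injective (hφ' ⟨_, hn⟩ rfl)⟩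
  · rw [abs_sub_comm]
    exact (hφ x).abs_dist_sub_dist_le (hφ y)

end GeodesicSphere

/-! ### Upper bounds from a surjection. -/

theorem GromovHausdorff.ghDist_comm (X Y : Type*) [MetricSpace X] [CompactSpace X] [Nonempty X]
    [MetricSpace Y] [CompactSpace Y] [Nonempty Y] : ghDist X Y = ghDist Y X :=
  dist_comm _ _

theorem GromovHausdorff.ghDist_le_half_of_surjective {X Y : Type*} [MetricSpace X] [CompactSpace X]
    [Nonempty X] [MetricSpace Y] [CompactSpace Y] [Nonempty Y] {φ : X → Y}
    (hφ : Function.Surjective φ) {ε : ℝ} (h : ∀ x y, |dist x y - dist (φ x) (φ y)| ≤ ε) :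
    ghDist X Y ≤ ε / 2 := by
  have := ghDist_le_of_approx_subsets (s := Set.univ) (fun x => φ x.1) (ε₁ := 0) (ε₂ := ε) (ε₃ := 0)
    (fun x => ⟨x, Set.mem_univ x, (dist_self x).le⟩)
    (fun y => by
      obtain ⟨x, rfl⟩ := hφ y
      exact ⟨⟨x, Set.mem_univ x⟩, (dist_self _).le⟩)
    (fun x y => h x y)
  linarith

theorem isCorrespondence_graph {X Y : Type*} {φ : Y → X} (hφ : Function.Surjective φ) :
    IsCorrespondence (Set.range fun y => (φ y, y)) := by
  constructor <;> rw [← Set.range_comp, Set.range_eq_univ]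
  · exact hφ
  · exact Function.surjective_id

theorem distortion_graph_le {X Y : Type*} [MetricSpace X] [MetricSpace Y] {φ : Y → X} {ε : ℝ}
    (h : ∀ x y, |dist x y - dist (φ x) (φ y)| ≤ ε) :
    distortion (Set.range fun y => (φ y, y)) ≤ ENNReal.ofReal ε := by
  refine iSup₂_le fun p hp => iSup₂_le fun q hq => ?_
  obtain ⟨x, rfl⟩ := hp
  obtain ⟨y, rfl⟩ := hq
  refine ENNReal.ofReal_le_ofReal ?_
  rw [abs_sub_comm]
  exact h x y

/-! ### Winding numbers of discrete loops. -/

section Winding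

/-- The transition angles around a triangle of close points of the circle add up to zero. -/
theorem arg_div_add_arg_div_eq {a b c : ℂ} (ha : a ≠ 0) (hb : b ≠ 0) (hc : c ≠ 0)
    (hab : |(b / a).arg| < 2 * π / 3) (hbc : |(c / b).arg| < 2 * π / 3)
    (hac : |(c / a).arg| < 2 * π / 3) : (b / a).arg + (c / b).arg = (c / a).arg := by
  have h : (((b / a).arg + (c / b).arg : ℝ) : Real.Angle) = ((c / a).arg : ℝ) := by
    rw [Real.Angle.coe_add, ← Complex.arg_mul_coe_angle (div_ne_zero hb ha) (div_ne_zero hc hb)]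
    congr 2
    field_simp
  obtain ⟨k, hk⟩ := Real.Angle.angle_eq_iff_two_pi_dvd_sub.mp h
  rw [abs_lt] at hab hbc hac
  -- Three angles below `2π/3` in absolute value cannot combine to a nonzero multiple of `2π`; this
  -- is where the constant arises.
  have hk1 : (k : ℝ) < 1 := by nlinarith [pi_pos]
  have hk2 : (-1 : ℝ) < k := by nlinarith [pi_pos]
  have hk0 : k = 0 := by
    have h1 : k < 1 := by exact_mod_cast hk1
    have h2 : -1 < k := by exact_mod_cast hk2
    omega
  rw [hk0, Int.cast_zero, mul_zero] at hk
  linarith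

theorem coe_sum_arg_div (F : ℕ → ℂ) (hF : ∀ j, F j ≠ 0) (n : ℕ) :
    ((∑ j ∈ Finset.range n, (F (j + 1) / F j).arg : ℝ) : Real.Angle) = (F n / F 0).arg := by
  induction n with
  | zero => simp [div_self (hF 0)]
  | succ n ih =>
    rw [Finset.sum_range_succ, Real.Angle.coe_add, ih,
      ← Complex.arg_mul_coe_angle (div_ne_zero (hF n) (hF 0)) (div_ne_zero (hF (n + 1)) (hF n))]
    congr 2
    have := hF n
    field_simp

/-- A discrete disc in the circle: if neighbouring points of a grid are close, its first row is
constant and its rows are periodic, then the last row cannot be antipodally symmetric. -/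
theorem not_antiperiodic_of_grid {N : ℕ} {F : ℕ → ℕ → ℂ} (hF : ∀ i j, F i j ≠ 0)
    (hrow : ∀ i j, |(F i (j + 1) / F i j).arg| < 2 * π / 3)
    (hcol : ∀ i j, |(F (i + 1) j / F i j).arg| < 2 * π / 3)
    (hdiag : ∀ i j, |(F (i + 1) (j + 1) / F i j).arg| < 2 * π / 3)
    (hper : ∀ i, F i (2 * N) = F i 0) (hconst : ∀ j, F 0 j = F 0 0) :
    ¬ ∀ j, F N (j + N) = -F N j := by
  intro hodd
  -- Cutting each cell along its diagonal gives two triangles; the column angles telescope along the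
  -- row and cancel by periodicity.
  have hstep : ∀ i, ∑ j ∈ Finset.range (2 * N), (F (i + 1) (j + 1) / F (i + 1) j).arg =
      ∑ j ∈ Finset.range (2 * N), (F i (j + 1) / F i j).arg := by
    intro i
    have hsq : ∀ j, (F (i + 1) (j + 1) / F (i + 1) j).arg = (F i (j + 1) / F i j).arg +
        ((F (i + 1) (j + 1) / F i (j + 1)).arg - (F (i + 1) j / F i j).arg) := by
      intro j
      have h1 := arg_div_add_arg_div_eq (hF i j) (hF i (j + 1)) (hF (i + 1) (j + 1))
        (hrow i j) (hcol i (j + 1)) (hdiag i j)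
      have h2 := arg_div_add_arg_div_eq (hF i j) (hF (i + 1) j) (hF (i + 1) (j + 1))
        (hcol i j) (hrow (i + 1) j) (hdiag i j)
      linarith
    rw [Finset.sum_congr rfl fun j _ => hsq j, Finset.sum_add_distrib,
      Finset.sum_range_sub (fun j => (F (i + 1) j / F i j).arg), hper, hper, sub_self, add_zero]
  have hzero : ∀ i, ∑ j ∈ Finset.range (2 * N), (F i (j + 1) / F i j).arg = 0 := by
    intro i
    induction i with
    | zero =>
      refine Finset.sum_eq_zero fun j _ => ?_
      rw [hconst (j + 1), hconst j, div_self (hF 0 0), Complex.arg_one]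
    | succ i ih => rw [hstep, ih]
  have hN := hzero N
  rw [two_mul, Finset.sum_range_add] at hN
  have hshift : ∀ j, F N (N + j + 1) / F N (N + j) = F N (j + 1) / F N j := by
    intro j
    rw [show N + j + 1 = j + 1 + N by ring, show N + j = j + N by ring, hodd, hodd, neg_div_neg_eq]
  simp only [hshift] at hN
  -- The two halves of the last row contribute equally. Yet half a turn leads from a point to its
  -- negative, so its sum is `π` modulo `2π`.
  have hhalf : ∑ j ∈ Finset.range N, (F N (j + 1) / F N j).arg = 0 := by linarith
  have hang := coe_sum_arg_div (F N) (hF N) N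
  have hNN := hodd 0
  rw [zero_add] at hNN
  rw [hhalf, hNN, neg_div, div_self (hF N 0), Complex.arg_neg_one, Real.Angle.coe_zero] at hang
  exact Real.Angle.pi_ne_zero hang.symm

end Winding

/-! ### Lower bound for maps from the 3-sphere to the circle. -/

namespace GeodesicSphere

/-- Spherical coordinates on an equatorial `2`-sphere of the `3`-sphere. -/
noncomputable def spherical (φ ψ : ℝ) : GeodesicSphere 3 :=
  ⟨!₂[sin φ * cos ψ, sin φ * sin ψ, cos φ, 0], by
    rw [EuclideanSpace.norm_eq, Fin.sum_univ_four, Real.sqrt_eq_one]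
    simp [mul_pow]
    linear_combination sin φ ^ 2 * sin_sq_add_cos_sq ψ + sin_sq_add_cos_sq φ⟩

theorem dist_spherical (φ ψ φ' ψ' : ℝ) : dist (spherical φ ψ) (spherical φ' ψ') =
    arccos (sin φ * sin φ' * cos (ψ - ψ') + cos φ * cos φ') := by
  rw [dist_def, PiLp.inner_apply, Fin.sum_univ_four]
  simp [spherical, vec, cos_sub]
  ring_nf

theorem spherical_zero (ψ ψ' : ℝ) : spherical 0 ψ = spherical 0 ψ' :=
  Subtype.ext (by simp [spherical])

theorem spherical_add_two_pi (φ ψ : ℝ) : spherical φ (ψ + 2 * π) = spherical φ ψ :=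
  Subtype.ext (by simp [spherical])

theorem spherical_pi_div_two_add_pi (ψ : ℝ) :
    spherical (π / 2) (ψ + π) = (spherical (π / 2) ψ).antipode := by
  refine Subtype.ext (PiLp.ext fun i => ?_)
  fin_cases i <;> simp [spherical, antipode, vec]

theorem dist_spherical_same_left (φ ψ ψ' : ℝ) :
    dist (spherical φ ψ) (spherical φ ψ') ≤ |ψ - ψ'| := by
  rcases le_total |ψ - ψ'| π with h | h
  · rw [dist_spherical]
    conv_rhs => rw [← arccos_cos (abs_nonneg (ψ - ψ')) h, cos_abs]
    refine arccos_le_arccos ?_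
    nlinarith [sin_sq_add_cos_sq φ, cos_le_one (ψ - ψ'), sq_nonneg (cos φ)]
  · exact (dist_le_pi _ _).trans h

theorem dist_spherical_same_right (φ φ' ψ : ℝ) :
    dist (spherical φ ψ) (spherical φ' ψ) ≤ |φ - φ'| := by
  rcases le_total |φ - φ'| π with h | h
  · rw [dist_spherical]
    conv_rhs => rw [← arccos_cos (abs_nonneg (φ - φ')) h, cos_abs, cos_sub]
    refine arccos_le_arccos ?_
    rw [sub_self, cos_zero]
    linarith
  · exact (dist_le_pi _ _).trans h

theorem dist_spherical_le (φ φ' ψ ψ' : ℝ) :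
    dist (spherical φ ψ) (spherical φ' ψ') ≤ |φ - φ'| + |ψ - ψ'| :=
  (dist_triangle _ (spherical φ' ψ) _).trans
    (add_le_add (dist_spherical_same_right _ _ _) (dist_spherical_same_left _ _ _))

/-- A map between spheres can be made odd without increasing its distortion. -/
theorem exists_odd_of_abs_dist_sub_dist_le {m n : ℕ} {D : ℝ}
    {g : GeodesicSphere n → GeodesicSphere m} (hg : ∀ x y, |dist (g x) (g y) - dist x y| ≤ D) :
    ∃ f : GeodesicSphere n → GeodesicSphere m, (∀ x, f x.antipode = (f x).antipode) ∧
      ∀ x y, |dist (f x) (f y) - dist x y| ≤ D := by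
  classical
  -- Any linear order selects one point from each antipodal pair; no continuity is needed.
  let _ : LinearOrder (GeodesicSphere n) := WellOrderingRel.isWellOrder.linearOrder
  refine ⟨fun x => if x < x.antipode then g x else (g x.antipode).antipode, fun x => ?_,
    fun x y => ?_⟩
  · simp only [antipode_antipode]
    rcases lt_or_gt_of_ne (antipode_ne x) with h | h
    · rw [if_pos h, if_neg h.not_gt, antipode_antipode]
    · rw [if_neg h.not_gt, if_pos h]
  · have key : ∀ a b c d : ℝ, a = π - c → b = π - d → |c - d| ≤ D → |a - b| ≤ D := by
      rintro a b c d rfl rfl h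
      rwa [sub_sub_sub_cancel_left, abs_sub_comm]
    have hxy := hg x.antipode y
    have hyx := hg x y.antipode
    have hh := hg x.antipode y.antipode
    rw [dist_antipode_left] at hxy
    rw [dist_antipode_right] at hyx
    rw [dist_antipode_left, dist_antipode_right] at hh
    dsimp only
    split_ifs
    · exact hg x y
    · exact key _ _ _ _ (dist_antipode_right _ _) (by ring) hyx
    · exact key _ _ _ _ (dist_antipode_left _ _) (by ring) hxy
    · rw [dist_antipode_left, dist_antipode_right]
      simpa only [sub_sub_cancel] using hh

theorem two_pi_div_three_le_of_abs_dist_sub_dist_le {D : ℝ}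
    {g : GeodesicSphere 3 → GeodesicSphere 1} (hg : ∀ x y, |dist (g x) (g y) - dist x y| ≤ D) :
    2 * π / 3 ≤ D := by
  by_contra! hD
  obtain ⟨f, hodd, hf⟩ := exists_odd_of_abs_dist_sub_dist_le hg
  -- A grid step moves each angle by at most `π / N`, so a diagonal one costs at most `2π / N`, less
  -- than the slack `2π/3 - D`.
  obtain ⟨N, hN⟩ := exists_nat_gt (2 * π / (2 * π / 3 - D))
  have hε : 0 < 2 * π / 3 - D := by linarith
  have hN0 : (0 : ℝ) < N := lt_of_le_of_lt (by positivity) hN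
  have hNε : 2 * (π / N) < 2 * π / 3 - D := by
    rw [div_lt_iff₀ hε] at hN
    rw [← mul_div_assoc, div_lt_iff₀ hN0]
    linarith
  have hδ : 0 < π / N := by positivity
  have hclose : ∀ φ φ' ψ ψ' : ℝ, |φ - φ'| ≤ π / N → |ψ - ψ'| ≤ π / N →
      |((f (spherical φ' ψ')).toComplex / (f (spherical φ ψ)).toComplex).arg| < 2 * π / 3 := by
    intro φ φ' ψ ψ' h1 h2
    rw [← dist_eq_abs_arg]
    linarith [(abs_le.mp (hf (spherical φ ψ) (spherical φ' ψ'))).2, dist_spherical_le φ φ' ψ ψ']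
  have hφ : ∀ i : ℕ, |(i : ℝ) * (π / 2 / N) - ((i + 1 : ℕ) : ℝ) * (π / 2 / N)| ≤ π / N := by
    intro i
    rw [show (i : ℝ) * (π / 2 / N) - ((i + 1 : ℕ) : ℝ) * (π / 2 / N) = -(π / N / 2) by
      push_cast; ring, abs_neg, abs_of_pos (by positivity)]
    linarith
  have hψ : ∀ j : ℕ, |(j : ℝ) * (π / N) - ((j + 1 : ℕ) : ℝ) * (π / N)| ≤ π / N := by
    intro j
    rw [show (j : ℝ) * (π / N) - ((j + 1 : ℕ) : ℝ) * (π / N) = -(π / N) by push_cast; ring,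
      abs_neg, abs_of_pos hδ]
  have hself : ∀ a : ℝ, |a - a| ≤ π / N := fun a => by rw [sub_self, abs_zero]; exact hδ.le
  -- Row `0` is the pole and row `N` the equator; `N` columns make half a turn.
  refine not_antiperiodic_of_grid (N := N)
    (F := fun i j => (f (spherical (i * (π / 2 / N)) (j * (π / N)))).toComplex)
    (fun i j => toComplex_ne_zero _) (fun i j => hclose _ _ _ _ (hself _) (hψ j))
    (fun i j => hclose _ _ _ _ (hφ i) (hself _)) (fun i j => hclose _ _ _ _ (hφ i) (hψ j))
    (fun i => ?_) (fun j => ?_) fun j => ?_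
  · rw [show ((2 * N : ℕ) : ℝ) * (π / N) = ((0 : ℕ) : ℝ) * (π / N) + 2 * π by
      push_cast; field_simp; ring, spherical_add_two_pi]
  · rw [Nat.cast_zero, zero_mul, spherical_zero]
  · rw [show (N : ℝ) * (π / 2 / N) = π / 2 by field_simp,
      show ((j + N : ℕ) : ℝ) * (π / N) = j * (π / N) + π by push_cast; field_simp,
      spherical_pi_div_two_add_pi, hodd, toComplex_antipode]

end GeodesicSphere

/-! ### From the Gromov–Hausdorff distance to maps. -/

/-- The optimal coupling attains the distance, so every `y` has a partner within `r` in it; moving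
both endpoints costs at most `2 * r`. -/
theorem GromovHausdorff.exists_abs_dist_sub_dist_le_of_ghDist_lt {X Y : Type*} [MetricSpace X]
    [CompactSpace X] [Nonempty X] [MetricSpace Y] [CompactSpace Y] [Nonempty Y] {r : ℝ}
    (h : ghDist X Y < r) : ∃ g : Y → X, ∀ x y, |dist (g x) (g y) - dist x y| ≤ 2 * r := by
  have hl := isometry_optimalGHInjl X Y
  have hr := isometry_optimalGHInjr X Y
  rw [← hausdorffDist_optimal] at h
  have hfin : Metric.hausdorffEDist (Set.range (optimalGHInjl X Y))
      (Set.range (optimalGHInjr X Y)) ≠ ⊤ :=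
    Metric.hausdorffEDist_ne_top_of_nonempty_of_bounded (Set.range_nonempty _)
      (Set.range_nonempty _) (isCompact_range hl.continuous).isBounded
      (isCompact_range hr.continuous).isBounded
  have hex : ∀ y : Y, ∃ x : X, dist (optimalGHInjl X Y x) (optimalGHInjr X Y y) < r := by
    intro y
    obtain ⟨_, ⟨x, rfl⟩, hx⟩ :=
      Metric.exists_dist_lt_of_hausdorffDist_lt' (Set.mem_range_self y) h hfin
    exact ⟨x, hx⟩
  choose g hg using hex
  refine ⟨g, fun x y => ?_⟩
  rw [← hl.dist_eq, ← hr.dist_eq, two_mul, ← Real.dist_eq]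
  exact (dist_dist_dist_le _ _ _ _).trans (add_le_add (hg x).le (hg y).le)

theorem mainTheorem3 :
    (∃ R : Set (GeodesicSphere 1 × GeodesicSphere 3),
      IsCorrespondence R ∧ distortion R ≤ ENNReal.ofReal (2 * Real.pi / 3)) ∧
    GromovHausdorff.ghDist (GeodesicSphere 1) (GeodesicSphere 3) = Real.pi / 3 := by
  obtain ⟨φ, hsurj, hφ⟩ := GeodesicSphere.exists_surjective_abs_dist_sub_dist_le
  refine ⟨⟨_, isCorrespondence_graph hsurj, distortion_graph_le hφ⟩, le_antisymm ?_ ?_⟩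
  · rw [GromovHausdorff.ghDist_comm]
    linarith [GromovHausdorff.ghDist_le_half_of_surjective hsurj hφ]
  · refine le_of_forall_gt_imp_ge_of_dense fun r hr => ?_
    obtain ⟨g, hg⟩ := GromovHausdorff.exists_abs_dist_sub_dist_le_of_ghDist_lt hr
    linarith [GeodesicSphere.two_pi_div_three_le_of_abs_dist_sub_dist_le hg]
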